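/- Let $m>0$ be a real number and $q\ge 1$ an integer, and put $\mathrm dA(z)=\pi^{-1}\,\mathrm dx\,\mathrm dy$ for $z=x+\mathrm iy\in\mathbb C$. Let $A^2_{m,q}(\mathbb C)$ be the space of all functions of the form $f(z)=\sum_{r=0}^{q-1}\bar z^{\,r}f_r(z)$ with $f_0,\dots,f_{q-1}$ entire and $$\|f\|^2=\int_{\mathbb C}|f(z)|^2\,\mathrm e^{-m|z|^2}\,\mathrm dA(z)<+\infty ,$$ with the inner product of $L^2(\mathbb C,\mathrm e^{-m|z|^2}\mathrm dA)$. For integers $\alpha,k\ge 0$ let $$L_k^{\alpha}(x)=\sum_{i=0}^{k}(-1)^i\binom{k+\alpha}{k-i}\frac{x^i}{i!}$$ be the generalized Laguerre polynomial. Then $A^2_{m,q}(\mathbb C)$ is a Hilbert space of functions with bounded point evaluations, and its reproducing kernel $K_{m,q}$ (that is, $K_{m,q}(\cdot,w)\in A^2_{m,q}(\mathbb C)$ and $f(w)=\int_{\mathbb C}f(z)\overline{K_{m,q}(z,w)}\,\mathrm e^{-m|z|^2}\,\mathrm dA(z)$ for all $f\in A^2_{m,q}(\mathbb C)$ and $w\in\mathbb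 C$) satisfies, for all $z,w\in\mathbb C$, $$K_{m,q}(z,w)=m\sum_{r=0}^{q-1}\sum_{i=0}^{\infty}\frac{r!}{(r+i)!}(mz\bar w)^i L_r^{i}(m|z|^2)L_r^{i}(m|w|^2)+m\sum_{j=0}^{q-2}\sum_{k=1}^{q-j-1}\frac{j!}{(j+k)!}(m\bar z w)^k L_j^{k}(m|z|^2)L_j^{k}(m|w|^2)=m\,L^{1}_{q-1}(m|z-w|^2)\,\mathrm e^{mz\bar w},$$ where each of the infinite series over $i$ converges absolutely, and the second double sum is empty when $q=1$. -/

import Mathlib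

open MeasureTheory ComplexConjugate

/-- The generalized Laguerre polynomial
`L^α_k(x) = ∑_{i=0}^k (-1)^i binom(k+α, k-i) x^i / i!`, for integer parameter `α ≥ 0`. -/
noncomputable def laguerreL (α k : ℕ) (x : ℝ) : ℝ :=
  ∑ i ∈ Finset.range (k + 1), (-1) ^ i * ((k + α).choose (k - i) : ℝ) * (x ^ i / (i.factorial : ℝ))

/-- `f` is polyanalytic of degree at most `q - 1` on `ℂ`: `f(z) = ∑_{r<q} z̄^r f_r(z)` with all
the `f_r` entire. -/
def IsPolyanalytic (q : ℕ) (f : ℂ → ℂ) : Prop :=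
  ∃ g : ℕ → ℂ → ℂ, (∀ r, Differentiable ℂ (g r)) ∧
    ∀ z, f z = ∑ r ∈ Finset.range q, conj z ^ r * g r z

/-- The measure `e^{-m|z|²} dA(z)`, where `dA = π⁻¹ dx dy`. -/
noncomputable def fockMeasure (m : ℝ) : Measure ℂ :=
  volume.withDensity fun z => ENNReal.ofReal (Real.pi⁻¹ * Real.exp (-m * ‖z‖ ^ 2))

theorem IsPolyanalytic.continuous {q : ℕ} {f : ℂ → ℂ} (hf : IsPolyanalytic q f) :
    Continuous f := by
  obtain ⟨g, hg, h⟩ := hf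
  have hc : ∀ r, Continuous (g r) := fun r => (hg r).continuous
  rw [funext h]
  have := Complex.continuous_conj
  fun_prop

/-- The polyanalytic functions of degree at most `q - 1` that are square integrable with
respect to `e^{-m|z|²} dA(z)`, as a vector space of functions on `ℂ`. -/
def polyFockSubmodule (m : ℝ) (q : ℕ) : Submodule ℂ (ℂ → ℂ) where
  carrier := {f | IsPolyanalytic q f ∧ MemLp f 2 (fockMeasure m)}
  add_mem' := by
    rintro f₁ f₂ ⟨⟨g₁, hg₁, h₁⟩, hm₁⟩ ⟨⟨g₂, hg₂, h₂⟩, hm₂⟩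
    refine ⟨⟨fun r => g₁ r + g₂ r, fun r => (hg₁ r).add (hg₂ r), fun z => ?_⟩, hm₁.add hm₂⟩
    simp [h₁, h₂, mul_add, Finset.sum_add_distrib]
  zero_mem' := ⟨⟨fun _ => 0, fun _ => differentiable_const _, fun z => by simp⟩, MemLp.zero⟩
  smul_mem' := by
    rintro c f ⟨⟨g, hg, h⟩, hm⟩
    refine ⟨⟨fun r => c • g r, fun r => (hg r).const_smul c, fun z => ?_⟩, hm.const_smul c⟩
    simp [h, Finset.mul_sum, mul_left_comm]

/-- The polyanalytic Bargmann-Fock space `A²_{m,q}(ℂ)`. This is a type of its own, so that its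
norm below is the weighted `L²` norm and no topology is inherited from `ℂ → ℂ`. -/
def PolyFock (m : ℝ) (q : ℕ) : Type := polyFockSubmodule m q

noncomputable instance (m : ℝ) (q : ℕ) : AddCommGroup (PolyFock m q) :=
  inferInstanceAs (AddCommGroup (polyFockSubmodule m q))

noncomputable instance (m : ℝ) (q : ℕ) : Module ℂ (PolyFock m q) :=
  inferInstanceAs (Module ℂ (polyFockSubmodule m q))

/-- The function on `ℂ` underlying an element of `A²_{m,q}(ℂ)`. -/
def PolyFock.toFun {m : ℝ} {q : ℕ} (f : PolyFock m q) : ℂ → ℂ := f.1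

theorem PolyFock.integrable_inner {m : ℝ} {q : ℕ} (f g : PolyFock m q) :
    Integrable (fun z => conj (f.toFun z) * g.toFun z) (fockMeasure m) :=
  (f.2.2.star).integrable_mul g.2.2

theorem PolyFock.toFun_eq_zero {m : ℝ} {q : ℕ} (f : PolyFock m q)
    (h : ∫ z, conj (f.toFun z) * f.toFun z ∂fockMeasure m = 0) : f.toFun = 0 := by
  have e : ∀ z, conj (f.toFun z) * f.toFun z = ((‖f.toFun z‖ ^ 2 : ℝ) : ℂ) := fun z => by
    rw [Complex.conj_mul']; push_cast; rfl
  have hi := f.integrable_inner f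
  simp only [e] at h hi
  rw [integral_complex_ofReal] at h
  have h0 : ∫ z, ‖f.toFun z‖ ^ 2 ∂fockMeasure m = 0 := by exact_mod_cast h
  have hir : Integrable (fun z => ‖f.toFun z‖ ^ 2) (fockMeasure m) := by
    exact (memLp_two_iff_integrable_sq_norm f.2.2.1).1 f.2.2
  rw [integral_eq_zero_iff_of_nonneg (fun z => by positivity) hir] at h0
  rw [fockMeasure, Filter.EventuallyEq, ae_withDensity_iff (by fun_prop)] at h0
  refine Continuous.ae_eq_iff_eq (μ := volume) f.2.1.continuous continuous_const |>.1 ?_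
  filter_upwards [h0] with z hz
  have hp : 0 < Real.pi⁻¹ * Real.exp (-m * ‖z‖ ^ 2) := by positivity
  have := hz (by simpa using hp)
  have h1 : f.toFun z = 0 := by simpa using this
  exact h1

/-- The inner product `⟪f, g⟫ = ∫ conj f(z) g(z) e^{-m|z|²} dA(z)` (conjugate-linear in the
first variable, as everywhere in Mathlib). -/
noncomputable instance PolyFock.core (m : ℝ) (q : ℕ) : InnerProductSpace.Core ℂ (PolyFock m q) where
  inner f g := ∫ z, conj (f.toFun z) * g.toFun z ∂fockMeasure m
  conj_inner_symm f g := by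
    rw [← integral_conj]
    simp [mul_comm]
  re_inner_nonneg f := by
    have e : ∀ z, conj (f.toFun z) * f.toFun z = ((‖f.toFun z‖ ^ 2 : ℝ) : ℂ) := fun z => by
      rw [Complex.conj_mul']; push_cast; rfl
    simp only [e]
    rw [integral_complex_ofReal]
    simpa using integral_nonneg fun z => by positivity
  add_left f g h := by
    have e : ∀ z, (f + g).toFun z = f.toFun z + g.toFun z := fun _ => rfl
    simp only [e, map_add, add_mul]
    exact integral_add (f.integrable_inner h) (g.integrable_inner h)
  smul_left f g c := by
    have e : ∀ z, (c • f).toFun z = c * f.toFun z := fun _ => rfl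
    simp only [e, map_mul, mul_assoc]
    exact integral_const_mul _ _
  definite f h := Subtype.ext (f.toFun_eq_zero h)

noncomputable instance (m : ℝ) (q : ℕ) : NormedAddCommGroup (PolyFock m q) :=
  (PolyFock.core m q).toNormedAddCommGroup

noncomputable instance (m : ℝ) (q : ℕ) : InnerProductSpace ℂ (PolyFock m q) :=
  InnerProductSpace.ofCore (PolyFock.core m q).toCore

/-! The proof starts from the closed form and shows that it reproduces. At `w = 0` the kernel is
radial. The mean over a circle of radius `ρ` of a polyanalytic `f` is a polynomial in `ρ²` of degree
less than `q` with constant term `f 0`, by Cauchy's formula. Against the weight, `L^1_{q-1}` kills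
the powers `1 ≤ n < q` and gives the constant weight one: this is the vanishing of a `q`-th
difference of a polynomial of degree `n < q`. A translation with an exponential factor
(`gaussian_mul_conj_fockKernel_add`) carries this to every `w`.

Completeness follows: an `L²` limit `F` of elements of the space agrees a.e. with `w ↦ ⟪K_w, F⟫`,
which is polyanalytic because the kernel is, in `w`.

The series comes from the bilinear sum of complex Hermite polynomials over `n`, `∑ H_{n,r} H_{n,r} /
n!`, which equals `r! L_r(|z-w|²) e^{z w̄}` (`hasSum_complexHermite_mul`). The terms `n ≥ r` form
the `r`-th Laguerre series. The finitely many terms `n < r` involve `z̄ w` and, summed over `r < q`,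
form the second double sum, while `∑_{r<q} L_r = L^1_{q-1}`. -/

/-! ### Complex Hermite polynomials and their bilinear sum. -/

/-- The complex Hermite (Itô) polynomials
`H_{n,r}(a, b) = ∑_k (-1)^k k! binom(n, k) binom(r, k) a^{n-k} b^{r-k}`. -/
noncomputable def complexHermite (n : ℕ) : ℕ → ℂ → ℂ → ℂ
  | 0, a, _ => a ^ n
  | r + 1, a, b => b * complexHermite n r a b - n * complexHermite (n - 1) r a b

/-- The definition recurses on `r` only; this mirror recursion restores the symmetry between the two
indices. The truncated `r - 1` is harmless at `r = 0` because of its factor `r`. -/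
theorem complexHermite_succ_left (n r : ℕ) (a b : ℂ) :
    complexHermite (n + 1) r a b =
      a * complexHermite n r a b - r * complexHermite n (r - 1) a b := by
  induction r generalizing n with
  | zero => simp [complexHermite, pow_succ']
  | succ r ih =>
    simp only [complexHermite, Nat.add_sub_cancel]
    rw [ih n]
    have h1 : (r : ℂ) * complexHermite n r a b = r * (b * complexHermite n (r - 1) a b
        - n * complexHermite (n - 1) (r - 1) a b) := by
      rcases r with _ | r
      · simp
      · simp [complexHermite]
    have h2 : (n : ℂ) * complexHermite n r a b = n * (a * complexHermite (n - 1) r a b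
        - r * complexHermite (n - 1) (r - 1) a b) := by
      rcases n with _ | n
      · simp
      · simp [ih n]
    push_cast
    linear_combination h1 - h2

theorem complexHermite_zero_left (r : ℕ) (a b : ℂ) : complexHermite 0 r a b = b ^ r := by
  induction r with
  | zero => simp [complexHermite]
  | succ r ih => simp [complexHermite, ih, pow_succ']

theorem complexHermite_symm (n r : ℕ) (a b : ℂ) :
    complexHermite n r a b = complexHermite r n b a := by
  induction n generalizing r with
  | zero => simp [complexHermite, complexHermite_zero_left]
  | succ n ih => rw [complexHermite_succ_left, complexHermite, ih, ih]

theorem complexHermite_eq_sum (n r : ℕ) (a b : ℂ) :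
    complexHermite n r a b = ∑ k ∈ Finset.range (r + 1),
      (-1) ^ k * (r.choose k : ℂ) * (n.descFactorial k : ℂ) * a ^ (n - k) * b ^ (r - k) := by
  induction r generalizing n with
  | zero => simp [complexHermite]
  | succ r ih =>
    have e1 : b * complexHermite n r a b = ∑ k ∈ Finset.range (r + 2),
        (-1) ^ k * (r.choose k : ℂ) * (n.descFactorial k : ℂ) * a ^ (n - k)
          * b ^ (r + 1 - k) := by
      rw [Finset.sum_range_succ, ih, Finset.mul_sum]
      simp only [Nat.choose_succ_self, Nat.cast_zero, mul_zero, zero_mul, add_zero]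
      refine Finset.sum_congr rfl fun k hk => ?_
      rw [Nat.sub_add_comm (Nat.lt_succ_iff.1 (Finset.mem_range.1 hk)), pow_succ]
      ring
    have e2 : (n : ℂ) * complexHermite (n - 1) r a b = ∑ k ∈ Finset.range (r + 1),
        (-1) ^ k * (r.choose k : ℂ) * (n.descFactorial (k + 1) : ℂ) * a ^ (n - (k + 1))
          * b ^ (r + 1 - (k + 1)) := by
      rw [ih, Finset.mul_sum]
      refine Finset.sum_congr rfl fun k _ => ?_
      rcases n with _ | n
      · simp
      · rw [Nat.succ_descFactorial_succ, Nat.add_sub_cancel, Nat.add_sub_add_right,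
          Nat.add_sub_add_right]
        push_cast
        ring
    rw [complexHermite, e1, e2, Finset.sum_range_succ', Finset.sum_range_succ' _ (r + 1),
      add_sub_right_comm, ← Finset.sum_sub_distrib]
    congr 1
    · refine Finset.sum_congr rfl fun k _ => ?_
      rw [Nat.choose_succ_succ]
      push_cast
      ring
    · simp

theorem complexHermite_add_left_eq_laguerreL (i r : ℕ) (a b : ℂ) (x : ℝ) (h : a * b = x) :
    complexHermite (r + i) r a b = (-1) ^ r * (r.factorial : ℂ) * a ^ i * (laguerreL i r x : ℂ) := by
  -- The Hermite sum runs over descending powers of `a * b`, the Laguerre sum over ascending ones.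
  rw [complexHermite_eq_sum, laguerreL, ← Finset.sum_range_reflect]
  push_cast
  rw [Finset.mul_sum]
  refine Finset.sum_congr rfl fun k hk => ?_
  have hk' : k ≤ r := Nat.lt_succ_iff.1 (Finset.mem_range.1 hk)
  have hc : (r.choose k : ℂ) = (r.factorial : ℂ) / (k.factorial * (r - k).factorial) :=
    Nat.cast_choose ℂ hk'
  have e2 : r + i - (r - k) = i + k := by omega
  have e3 : r - (r - k) = k := by omega
  have hs : (-1 : ℂ) ^ (r - k) = (-1) ^ r * (-1) ^ k := by
    rw [← pow_add, show r + k = (r - k) + 2 * k by omega, pow_add, pow_mul]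
    simp
  rw [e2, e3, Nat.choose_symm hk', Nat.descFactorial_eq_factorial_mul_choose, hc, ← h, hs]
  have := Nat.factorial_ne_zero k
  have := Nat.factorial_ne_zero (r - k)
  push_cast
  field_simp
  ring

/-- With weights `1 / n!`, the operator `g ↦ n g(n-1)` is adjoint to the shift `f ↦ f(n+1)`; the
term `n = 0` vanishes. -/
theorem hasSum_nat_mul_factorial {f g : ℕ → ℂ} {s : ℂ}
    (h : HasSum (fun n => f (n + 1) * g n / (n.factorial : ℂ)) s) :
    HasSum (fun n => f n * (n * g (n - 1)) / (n.factorial : ℂ)) s := by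
  rw [← hasSum_nat_add_iff' 1]
  simp only [Finset.range_one, Finset.sum_singleton, Nat.cast_zero, zero_mul, mul_zero, zero_div,
    sub_zero, Nat.add_sub_cancel]
  refine h.congr_fun fun n => ?_
  rw [Nat.factorial_succ]
  have := Nat.factorial_ne_zero n
  have : (n : ℂ) + 1 ≠ 0 := Nat.cast_add_one_ne_zero n
  push_cast
  field_simp

theorem hasSum_complexHermite_zero (r : ℕ) (z z' w w' : ℂ) :
    HasSum (fun n : ℕ => complexHermite n 0 w' w * complexHermite n r z z' / (n.factorial : ℂ))
      ((z' - w') ^ r * Complex.exp (z * w')) := by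
  induction r with
  | zero =>
    have := NormedSpace.expSeries_div_hasSum_exp (z * w')
    rw [← Complex.exp_eq_exp_ℂ] at this
    simpa [complexHermite, mul_pow, mul_comm] using this
  | succ r ih =>
    have h1 := ih.mul_left z'
    have h2 : HasSum (fun n => complexHermite n 0 w' w * (n * complexHermite (n - 1) r z z') /
        (n.factorial : ℂ)) (w' * ((z' - w') ^ r * Complex.exp (z * w'))) := by
      refine hasSum_nat_mul_factorial (g := fun n => complexHermite n r z z') ?_
      refine (ih.mul_left w').congr_fun fun n => ?_
      simp only [complexHermite, pow_succ]
      ring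
    convert! h1.sub h2 using 1
    · ext n
      simp only [complexHermite]
      ring
    · ring

/-- Expanding `H_{n,p+1}` produces `n H_{n-1,p}`. Adjointness moves the shift onto `H_{n+1,r}`,
which `complexHermite_succ_left` expands. The result is the recursion for `H_{r,p+1}` at the
differences, up to sign. It involves `r - 1`, so `r` must vary in the induction. -/
theorem hasSum_complexHermite_mul (r p : ℕ) (z z' w w' : ℂ) :
    HasSum (fun n : ℕ => complexHermite n r z z' * complexHermite n p w' w / (n.factorial : ℂ))
      ((-1) ^ p * complexHermite r p (z' - w') (z - w) * Complex.exp (z * w')) := by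
  induction p generalizing r with
  | zero =>
    simpa [complexHermite, mul_comm] using hasSum_complexHermite_zero r z z' w w'
  | succ p ih =>
    have h2 := hasSum_nat_mul_factorial (f := fun n => complexHermite n r z z')
      (g := fun n => complexHermite n p w' w) (s := z * ((-1) ^ p * complexHermite r p (z' - w')
        (z - w) * Complex.exp (z * w')) - r * ((-1) ^ p * complexHermite (r - 1) p (z' - w')
        (z - w) * Complex.exp (z * w'))) (by
        refine (((ih r).mul_left z).sub ((ih (r - 1)).mul_left (r : ℂ))).congr_fun fun n => ?_
        rw [complexHermite_succ_left]
        ring)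
    convert! ((ih r).mul_left w).sub h2 using 1
    · ext n
      simp only [complexHermite]
      ring
    · simp only [complexHermite, pow_succ]
      ring

/-! ### Laguerre identities. -/

theorem laguerreL_one_succ (n : ℕ) (x : ℝ) :
    laguerreL 1 (n + 1) x = laguerreL 1 n x + laguerreL 0 (n + 1) x := by
  have e : laguerreL 1 n x = ∑ i ∈ Finset.range (n + 1),
      (-1) ^ i * ((n + 1).choose (n - i) : ℝ) * (x ^ i / (i.factorial : ℝ)) := rfl
  rw [e, laguerreL, laguerreL, Finset.sum_range_succ, Finset.sum_range_succ _ (n + 1), ← add_assoc,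
    ← Finset.sum_add_distrib]
  congr 1
  · refine Finset.sum_congr rfl fun i hi => ?_
    rw [Nat.sub_add_comm (Nat.lt_succ_iff.1 (Finset.mem_range.1 hi)), Nat.choose_succ_succ,
      Nat.add_zero]
    push_cast
    ring
  · simp

theorem laguerreL_one_eq_sum (n : ℕ) (x : ℝ) :
    laguerreL 1 n x = ∑ r ∈ Finset.range (n + 1), laguerreL 0 r x := by
  induction n with
  | zero => simp [laguerreL]
  | succ n ih => rw [laguerreL_one_succ, Finset.sum_range_succ, ih]

/-- Since `(n+i)!/i!` is `x(x+1)⋯(x+n-1)` at `x = i+1`, the sum is, up to sign, the `q`-th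
difference of this polynomial at `0` without its term at `x = 0`. The full difference vanishes as `n
< q`, and the missing term is `1` or `0` according to whether `n = 0`. -/
theorem sum_neg_one_pow_mul_choose_mul_ascFactorial {q n : ℕ} (hn : n < q) :
    ∑ i ∈ Finset.range q, (-1 : ℝ) ^ i * (q.choose (q - 1 - i) : ℝ) *
      (((n + i).factorial : ℝ) / (i.factorial : ℝ)) = if n = 0 then 1 else 0 := by
  have key := Polynomial.fwdDiff_iter_eq_zero_of_degree_lt (R := ℝ) (P := ascPochhammer ℝ n) (n := q)
    (by rw [ascPochhammer_natDegree]; exact hn)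
  have key0 := congrFun key 0
  rw [fwdDiff_iter_eq_sum_shift, Finset.sum_range_succ'] at key0
  have hS : ∑ i ∈ Finset.range q, (-1 : ℝ) ^ i * (q.choose (q - 1 - i) : ℝ) *
      (((n + i).factorial : ℝ) / (i.factorial : ℝ)) = (-1) ^ (q + 1) * ∑ i ∈ Finset.range q,
        (((-1 : ℤ) ^ (q - (i + 1)) * (q.choose (i + 1) : ℤ)) •
          (ascPochhammer ℝ n).eval (0 + (i + 1) • (1 : ℝ))) := by
    rw [Finset.mul_sum]
    refine Finset.sum_congr rfl fun i hi => ?_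
    have hi' := Finset.mem_range.1 hi
    have e1 : q.choose (q - 1 - i) = q.choose (i + 1) := by
      rw [← Nat.choose_symm (show i + 1 ≤ q by omega)]
      congr 1
      omega
    have e2 : (-1 : ℝ) ^ (q + 1) * (-1) ^ (q - (i + 1)) = (-1) ^ i := by
      rw [← pow_add, show q + 1 + (q - (i + 1)) = i + 2 * (q - i) by omega, pow_add, pow_mul]
      simp
    have e3 : (ascPochhammer ℝ n).eval (0 + (i + 1) • (1 : ℝ)) =
        ((n + i).factorial : ℝ) / (i.factorial : ℝ) := by
      have h := ascPochhammer_nat_eq_ascFactorial (i + 1) n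
      have h2 := Nat.factorial_mul_ascFactorial i n
      have : (0 + (i + 1) • (1 : ℝ)) = ((i + 1 : ℕ) : ℝ) := by simp
      rw [this, ← ascPochhammer_eval_cast, h, add_comm n i, ← h2]
      have := Nat.factorial_ne_zero i
      push_cast
      field_simp
    rw [e1, e3, zsmul_eq_mul, ← e2]
    push_cast
    ring
  rw [hS]
  have h0 : (ascPochhammer ℝ n).eval (0 + 0 • (1 : ℝ)) = if n = 0 then 1 else 0 := by
    simp [ascPochhammer_eval_zero]
  rw [h0] at key0
  have hfin : ∀ S c : ℝ, S + ((-1 : ℤ) ^ (q - 0) * (q.choose 0 : ℤ)) • c = 0 →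
      (-1) ^ (q + 1) * S = c := by
    intro S c h
    have h1 : ((-1 : ℝ) ^ q) * (-1) ^ q = 1 := by rw [← mul_pow]; simp
    simp at h
    rw [pow_succ]
    linear_combination (-(-1) ^ q) * h + c * h1
  exact hfin _ _ key0

/-! ### Exponential growth and integrability against the Gaussian. -/

/-- Functions on `ℂ` of at most exponential growth. -/
def ExpBounded (h : ℂ → ℂ) : Prop := ∃ C A : ℝ, ∀ z, ‖h z‖ ≤ C * Real.exp (A * ‖z‖)

theorem ExpBounded.exists_nonneg {h : ℂ → ℂ} (C A : ℝ) (H : ∀ z, ‖h z‖ ≤ C * Real.exp (A * ‖z‖)) :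
    ∃ C A : ℝ, 0 ≤ C ∧ 0 ≤ A ∧ ∀ z, ‖h z‖ ≤ C * Real.exp (A * ‖z‖) := by
  refine ⟨|C|, |A|, abs_nonneg _, abs_nonneg _, fun z => (H z).trans ?_⟩
  gcongr
  · exact le_abs_self C
  · exact le_abs_self A

theorem ExpBounded.const (c : ℂ) : ExpBounded fun _ => c := ⟨‖c‖, 0, fun z => by simp⟩

theorem ExpBounded.add {h k : ℂ → ℂ} (hh : ExpBounded h) (hk : ExpBounded k) :
    ExpBounded fun z => h z + k z := by
  obtain ⟨C, A, H⟩ := hh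
  obtain ⟨D, B, K⟩ := hk
  obtain ⟨C, A, hC, hA, H⟩ := ExpBounded.exists_nonneg C A H
  obtain ⟨D, B, hD, hB, K⟩ := ExpBounded.exists_nonneg D B K
  refine ⟨C + D, max A B, fun z => (norm_add_le _ _).trans ?_⟩
  rw [add_mul]
  refine add_le_add ((H z).trans ?_) ((K z).trans ?_)
  · gcongr
    exact le_max_left _ _
  · gcongr
    exact le_max_right _ _

theorem ExpBounded.mul {h k : ℂ → ℂ} (hh : ExpBounded h) (hk : ExpBounded k) :
    ExpBounded fun z => h z * k z := by
  obtain ⟨C, A, H⟩ := hh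
  obtain ⟨D, B, K⟩ := hk
  refine ⟨C * D, A + B, fun z => ?_⟩
  rw [norm_mul, add_mul, Real.exp_add, mul_mul_mul_comm]
  exact mul_le_mul (H z) (K z) (norm_nonneg _) ((norm_nonneg _).trans (H z))

theorem ExpBounded.pow {h : ℂ → ℂ} (hh : ExpBounded h) (n : ℕ) : ExpBounded fun z => h z ^ n := by
  induction n with
  | zero => simpa using ExpBounded.const 1
  | succ n ih => simpa only [pow_succ] using ih.mul hh

theorem ExpBounded.sum {ι : Type*} (s : Finset ι) {h : ι → ℂ → ℂ} (hh : ∀ i ∈ s, ExpBounded (h i)) :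
    ExpBounded fun z => ∑ i ∈ s, h i z := by
  classical
  induction s using Finset.induction_on with
  | empty => simpa using ExpBounded.const 0
  | insert a s ha ih =>
    simp only [Finset.sum_insert ha]
    exact (hh a (Finset.mem_insert_self a s)).add
      (ih fun i hi => hh i (Finset.mem_insert_of_mem hi))

theorem ExpBounded.congr_norm {h k : ℂ → ℂ} (hh : ExpBounded h) (e : ∀ z, ‖k z‖ = ‖h z‖) :
    ExpBounded k := by
  obtain ⟨C, A, H⟩ := hh
  exact ⟨C, A, fun z => (e z).trans_le (H z)⟩

theorem ExpBounded.id : ExpBounded fun z => z :=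
  ⟨1, 1, fun z => by have := Real.add_one_le_exp ‖z‖; simp; linarith⟩

theorem ExpBounded.conj : ExpBounded fun z => conj z :=
  ExpBounded.id.congr_norm fun z => by simp

theorem norm_exp_le_exp_norm (z : ℂ) : ‖Complex.exp z‖ ≤ Real.exp ‖z‖ := by
  rw [Complex.norm_exp]
  exact Real.exp_le_exp.2 (Complex.re_le_norm z)

theorem ExpBounded.exp_mul (c : ℂ) : ExpBounded fun z => Complex.exp (c * z) :=
  ⟨1, ‖c‖, fun z => by simpa using norm_exp_le_exp_norm (c * z)⟩

theorem integrable_exp_norm_mul_gaussian {m : ℝ} (hm : 0 < m) (A : ℝ) :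
    Integrable fun z : ℂ => Real.exp (A * ‖z‖) * Real.exp (-m * ‖z‖ ^ 2) := by
  have h0 : Integrable fun z : ℂ => Real.exp (-(m / 2) * ‖z‖ ^ 2) := by
    have := GaussianFourier.integrable_cexp_neg_mul_sq_norm_add (V := ℂ) (b := (m / 2 : ℝ))
      (by simpa using hm) 0 0
    refine this.norm.congr (Filter.Eventually.of_forall fun z => ?_)
    simp only [Complex.norm_exp]
    congr 1
    simp only [zero_mul, add_zero]
    rw [← Complex.ofReal_pow, ← Complex.ofReal_neg, ← Complex.ofReal_mul, Complex.ofReal_re]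
  refine (h0.const_mul (Real.exp (A ^ 2 / (2 * m)))).mono' (by fun_prop)
    (Filter.Eventually.of_forall fun z => ?_)
  rw [← Real.exp_add, ← Real.exp_add, Real.norm_eq_abs, Real.abs_exp, Real.exp_le_exp]
  -- Completing the square: half of the Gaussian decay absorbs the exponential growth.
  have : A ^ 2 / (2 * m) + -(m / 2) * ‖z‖ ^ 2 - (A * ‖z‖ + -m * ‖z‖ ^ 2) =
      (A - m * ‖z‖) ^ 2 / (2 * m) := by
    field_simp
    ring
  have h2 : 0 ≤ (A - m * ‖z‖) ^ 2 / (2 * m) := by positivity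
  linarith

theorem integral_fockMeasure (m : ℝ) (f : ℂ → ℂ) :
    ∫ z, f z ∂fockMeasure m =
      ∫ z, ((Real.pi⁻¹ * Real.exp (-m * ‖z‖ ^ 2) : ℝ) : ℂ) * f z := by
  rw [fockMeasure, integral_withDensity_eq_integral_toReal_smul (by fun_prop)
    (Filter.Eventually.of_forall fun _ => ENNReal.ofReal_lt_top)]
  refine integral_congr_ae (Filter.Eventually.of_forall fun z => ?_)
  have : 0 ≤ Real.pi⁻¹ * Real.exp (-m * ‖z‖ ^ 2) := by positivity
  simp only [ENNReal.toReal_ofReal this, Complex.real_smul]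

theorem integrable_fockMeasure_iff {E : Type*} [NormedAddCommGroup E] [NormedSpace ℝ E] (m : ℝ)
    (f : ℂ → E) : Integrable f (fockMeasure m) ↔
      Integrable fun z => (Real.pi⁻¹ * Real.exp (-m * ‖z‖ ^ 2)) • f z := by
  rw [fockMeasure, integrable_withDensity_iff_integrable_smul' (by fun_prop)
    (Filter.Eventually.of_forall fun _ => ENNReal.ofReal_lt_top)]
  refine integrable_congr (Filter.Eventually.of_forall fun z => ?_)
  have : 0 ≤ Real.pi⁻¹ * Real.exp (-m * ‖z‖ ^ 2) := by positivity
  simp only [ENNReal.toReal_ofReal this]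

theorem ExpBounded.memLp {h : ℂ → ℂ} (hh : ExpBounded h) (hc : Continuous h) {m : ℝ} (hm : 0 < m) :
    MemLp h 2 (fockMeasure m) := by
  rw [memLp_two_iff_integrable_sq_norm hc.aestronglyMeasurable, integrable_fockMeasure_iff]
  obtain ⟨C, A, H⟩ := hh
  refine ((integrable_exp_norm_mul_gaussian hm (2 * A)).const_mul (Real.pi⁻¹ * C ^ 2)).mono'
    (by fun_prop) (Filter.Eventually.of_forall fun z => ?_)
  have h1 : ‖h z‖ ^ 2 ≤ (C * Real.exp (A * ‖z‖)) ^ 2 := by gcongr; exact H z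
  have h2 : (C * Real.exp (A * ‖z‖)) ^ 2 = C ^ 2 * Real.exp (2 * A * ‖z‖) := by
    rw [mul_pow, ← Real.exp_nat_mul]
    congr 2
    push_cast
    ring
  rw [h2] at h1
  rw [norm_smul, Real.norm_of_nonneg (by positivity), Real.norm_of_nonneg (by positivity)]
  calc _ ≤ Real.pi⁻¹ * Real.exp (-m * ‖z‖ ^ 2) * (C ^ 2 * Real.exp (2 * A * ‖z‖)) := by gcongr
    _ = _ := by ring

/-! ### Polyanalytic functions and the closed-form kernel. -/

theorem IsPolyanalytic.sum {ι : Type*} (s : Finset ι) {q : ℕ} {f : ι → ℂ → ℂ}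
    (hf : ∀ i ∈ s, IsPolyanalytic q (f i)) : IsPolyanalytic q fun z => ∑ i ∈ s, f i z := by
  choose! g hg h using hf
  refine ⟨fun r z => ∑ i ∈ s, g i r z, fun r => Differentiable.fun_sum fun i hi => hg i hi r,
    fun z => ?_⟩
  simp only [Finset.mul_sum]
  rw [Finset.sum_comm]
  exact Finset.sum_congr rfl fun i hi => h i hi z

theorem IsPolyanalytic.mul_differentiable {q : ℕ} {f h : ℂ → ℂ} (hf : IsPolyanalytic q f)
    (hh : Differentiable ℂ h) : IsPolyanalytic q fun z => f z * h z := by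
  obtain ⟨g, hg, e⟩ := hf
  refine ⟨fun r z => g r z * h z, fun r => (hg r).mul hh, fun z => ?_⟩
  simp only [e, Finset.sum_mul, mul_assoc]

theorem isPolyanalytic_conj_pow {q b : ℕ} (hb : b < q) : IsPolyanalytic q fun z => conj z ^ b := by
  refine ⟨fun r _ => if r = b then 1 else 0, fun r => differentiable_const _, fun z => ?_⟩
  simp [hb]

theorem isPolyanalytic_conj_sub_pow {q i : ℕ} (hi : i < q) (c : ℂ) :
    IsPolyanalytic q fun z => (conj z - c) ^ i := by
  have e : (fun z : ℂ => (conj z - c) ^ i) = fun z => ∑ b ∈ Finset.range (i + 1),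
      conj z ^ b * ((-c) ^ (i - b) * (i.choose b : ℂ)) := by
    ext z
    rw [sub_eq_add_neg, add_pow]
    simp only [mul_assoc]
  rw [e]
  refine IsPolyanalytic.sum _ fun b hb => (isPolyanalytic_conj_pow ?_).mul_differentiable
    (differentiable_const _)
  have := Finset.mem_range.1 hb
  omega

theorem IsPolyanalytic.comp_add {q : ℕ} {f : ℂ → ℂ} (hf : IsPolyanalytic q f) (w : ℂ) :
    IsPolyanalytic q fun z => f (z + w) := by
  obtain ⟨g, hg, e⟩ := hf
  have : (fun z => f (z + w)) =
      fun z => ∑ r ∈ Finset.range q, (conj z - -conj w) ^ r * g r (z + w) := by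
    ext z
    simp [e]
  rw [this]
  refine IsPolyanalytic.sum _ fun r hr => (isPolyanalytic_conj_sub_pow
    (Finset.mem_range.1 hr) _).mul_differentiable ?_
  exact (hg r).comp (differentiable_id.add_const w)

/-- The closed form of the reproducing kernel of `A²_{m,q}(ℂ)`. -/
noncomputable def fockKernel (m : ℝ) (q : ℕ) (z w : ℂ) : ℂ :=
  (m : ℂ) * (laguerreL 1 (q - 1) (m * ‖z - w‖ ^ 2) : ℂ) * Complex.exp (m * z * conj w)

/-- The coefficient of `x^i` in `m L^1_{q-1}(m x)`. -/
noncomputable def fockKernelCoeff (m : ℝ) (q i : ℕ) : ℝ :=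
  m * ((-1) ^ i * (q.choose (q - 1 - i) : ℝ) * (m ^ i / (i.factorial : ℝ)))

theorem mul_laguerreL_one_eq_sum (m : ℝ) {q : ℕ} (hq : 1 ≤ q) (x : ℝ) :
    m * laguerreL 1 (q - 1) (m * x) = ∑ i ∈ Finset.range q, fockKernelCoeff m q i * x ^ i := by
  rw [laguerreL, Nat.sub_add_cancel hq, Finset.mul_sum]
  refine Finset.sum_congr rfl fun i _ => ?_
  rw [fockKernelCoeff, mul_pow]
  ring

theorem fockKernel_eq_sum (m : ℝ) {q : ℕ} (hq : 1 ≤ q) (z w : ℂ) :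
    fockKernel m q z w = ∑ i ∈ Finset.range q, (conj z - conj w) ^ i *
      ((fockKernelCoeff m q i : ℂ) * (z - w) ^ i * Complex.exp (m * conj w * z)) := by
  rw [fockKernel, ← Complex.ofReal_mul, mul_laguerreL_one_eq_sum m hq, Complex.ofReal_sum,
    Finset.sum_mul]
  refine Finset.sum_congr rfl fun i _ => ?_
  push_cast
  rw [← Complex.conj_mul', map_sub, mul_pow]
  ring_nf

theorem isPolyanalytic_fockKernel (m : ℝ) {q : ℕ} (hq : 1 ≤ q) (w : ℂ) :
    IsPolyanalytic q fun z => fockKernel m q z w := by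
  simp only [fockKernel_eq_sum m hq]
  exact IsPolyanalytic.sum _ fun i hi => (isPolyanalytic_conj_sub_pow
    (Finset.mem_range.1 hi) _).mul_differentiable (by fun_prop)

theorem expBounded_fockKernel (m : ℝ) {q : ℕ} (hq : 1 ≤ q) (w : ℂ) :
    ExpBounded fun z => fockKernel m q z w := by
  simp only [fockKernel_eq_sum m hq, sub_eq_add_neg]
  exact ExpBounded.sum _ fun i _ => ((ExpBounded.conj.add (.const _)).pow i).mul
    (((ExpBounded.const _).mul ((ExpBounded.id.add (.const _)).pow i)).mul (.exp_mul _))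

theorem memLp_fockKernel {m : ℝ} (hm : 0 < m) {q : ℕ} (hq : 1 ≤ q) (w : ℂ) :
    MemLp (fun z => fockKernel m q z w) 2 (fockMeasure m) :=
  (expBounded_fockKernel m hq w).memLp (isPolyanalytic_fockKernel m hq w).continuous hm

theorem conj_fockKernel (m : ℝ) (q : ℕ) (z w : ℂ) :
    conj (fockKernel m q z w) = fockKernel m q w z := by
  simp only [fockKernel, map_mul, Complex.conj_ofReal, ← Complex.exp_conj, Complex.conj_conj]
  rw [norm_sub_rev]
  ring_nf

/-! ### The reproducing property at the origin, in polar coordinates. -/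

theorem polarCoord_symm_eq_circleMap (p : ℝ × ℝ) :
    Complex.polarCoord.symm p = circleMap 0 p.1 p.2 := by
  rw [Complex.polarCoord_symm_apply, circleMap_zero, Complex.exp_mul_I, Complex.ofReal_cos,
    Complex.ofReal_sin]

theorem integral_eq_integral_circleMap {g : ℂ → ℂ} (hc : Continuous g) (hg : Integrable g) :
    ∫ z, g z = ∫ ρ in Set.Ioi (0 : ℝ), (ρ : ℂ) * ∫ θ in (-Real.pi)..Real.pi, g (circleMap 0 ρ θ) := by
  have hcirc : Continuous fun p : ℝ × ℝ => circleMap 0 p.1 p.2 := by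
    unfold circleMap
    fun_prop
  have hint : IntegrableOn (fun p : ℝ × ℝ => (p.1 : ℂ) * g (circleMap 0 p.1 p.2))
      (Set.Ioi (0 : ℝ) ×ˢ Set.Ioo (-Real.pi) Real.pi) (volume.prod volume) := by
    refine ⟨(by fun_prop : Continuous _).aestronglyMeasurable, ?_⟩
    rw [HasFiniteIntegral]
    have h := Complex.lintegral_comp_polarCoord_symm fun z => ‖g z‖ₑ
    have h2 := hg.2
    rw [HasFiniteIntegral, ← h] at h2
    refine lt_of_le_of_lt (le_of_eq ?_) h2
    refine setLIntegral_congr_fun (measurableSet_Ioi.prod measurableSet_Ioo) fun p hp => ?_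
    rw [polarCoord_symm_eq_circleMap, enorm_mul, smul_eq_mul]
    congr 1
    rw [← ofReal_norm, Complex.norm_real, Real.norm_of_nonneg (le_of_lt hp.1)]
  rw [← Complex.integral_comp_polarCoord_symm, polarCoord_target]
  simp_rw [polarCoord_symm_eq_circleMap, Complex.real_smul]
  rw [Measure.volume_eq_prod, setIntegral_prod _ hint]
  refine integral_congr_ae (Filter.Eventually.of_forall fun ρ => ?_)
  simp only
  rw [integral_const_mul, intervalIntegral.integral_of_le (by linarith [Real.pi_pos]),
    integral_Ioc_eq_integral_Ioo]

/-- On the circle `z̄ = ρ² / z`, so the integral is Cauchy's formula for the `r`-th Taylor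
coefficient of `g`. -/
theorem integral_circleMap_conj_pow_mul {g : ℂ → ℂ} (hg : Differentiable ℂ g) (r : ℕ) {ρ : ℝ}
    (hρ : 0 < ρ) :
    ∫ θ in (-Real.pi)..Real.pi, conj (circleMap 0 ρ θ) ^ r * g (circleMap 0 ρ θ) =
      2 * Real.pi * ((iteratedDeriv r g 0 / (r.factorial : ℂ)) * (ρ : ℂ) ^ (2 * r)) := by
  have hper : Function.Periodic
      (fun θ => conj (circleMap 0 ρ θ) ^ r * g (circleMap 0 ρ θ)) (2 * Real.pi) := fun θ => by
    simp only [periodic_circleMap 0 ρ θ]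
  have h := hper.intervalIntegral_add_eq (-Real.pi) 0
  rw [show -Real.pi + 2 * Real.pi = Real.pi by ring, zero_add] at h
  rw [h]
  have hC := (hg.differentiableOn (s := Metric.closedBall 0 ρ)).circleIntegral_one_div_sub_center_pow_smul
    hρ r
  rw [circleIntegral] at hC
  have e : ∀ θ : ℝ, deriv (circleMap 0 ρ) θ • (1 / (circleMap 0 ρ θ - 0) ^ (r + 1)) •
      g (circleMap 0 ρ θ) = (Complex.I / (ρ : ℂ) ^ (2 * r)) *
        (conj (circleMap 0 ρ θ) ^ r * g (circleMap 0 ρ θ)) := by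
    intro θ
    have hne : circleMap 0 ρ θ ≠ 0 := circleMap_ne_center hρ.ne'
    have hn : conj (circleMap 0 ρ θ) * circleMap 0 ρ θ = (ρ : ℂ) ^ 2 := by
      rw [Complex.conj_mul', norm_circleMap_zero, abs_of_pos hρ]
    have hρ' : (ρ : ℂ) ≠ 0 := by exact_mod_cast hρ.ne'
    rw [deriv_circleMap, sub_zero, smul_eq_mul, smul_eq_mul, pow_mul, ← hn, mul_pow]
    have hc : conj (circleMap 0 ρ θ) ≠ 0 := by simpa using hne
    field_simp
    ring
  simp_rw [e] at hC
  rw [intervalIntegral.integral_const_mul, smul_eq_mul] at hC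
  have hρ' : (ρ : ℂ) ≠ 0 := by exact_mod_cast hρ.ne'
  have hI := Complex.I_ne_zero
  have hf : (r.factorial : ℂ) ≠ 0 := by exact_mod_cast r.factorial_ne_zero
  field_simp at hC ⊢
  linear_combination hC

theorem IsPolyanalytic.exists_integral_circleMap {q : ℕ} (hq : 1 ≤ q) {f : ℂ → ℂ}
    (hf : IsPolyanalytic q f) : ∃ c : ℕ → ℂ, c 0 = f 0 ∧ ∀ ρ : ℝ, 0 < ρ →
      ∫ θ in (-Real.pi)..Real.pi, f (circleMap 0 ρ θ) =
        2 * Real.pi * ∑ r ∈ Finset.range q, c r * (ρ : ℂ) ^ (2 * r) := by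
  obtain ⟨g, hg, e⟩ := hf
  -- Only `c 0 = f 0` matters later: the radial integration annihilates the other coefficients.
  refine ⟨fun r => iteratedDeriv r (g r) 0 / (r.factorial : ℂ), ?_, fun ρ hρ => ?_⟩
  · rw [e, Finset.sum_eq_single_of_mem 0 (Finset.mem_range.2 hq)]
    · simp
    · intro r _ hr
      simp [hr]
  · simp only [e]
    rw [intervalIntegral.integral_finsetSum, Finset.mul_sum]
    · exact Finset.sum_congr rfl fun r _ => integral_circleMap_conj_pow_mul (hg r) r hρ
    · intro r _
      have h1 := Complex.continuous_conj
      have h2 := (hg r).continuous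
      have h3 := continuous_circleMap 0 ρ
      exact (by fun_prop : Continuous _).intervalIntegrable _ _

theorem integral_pow_mul_gaussian {m : ℝ} (hm : 0 < m) (n : ℕ) :
    ∫ x in Set.Ioi (0 : ℝ), x ^ (2 * n + 1) * Real.exp (-m * x ^ 2) =
      (n.factorial : ℝ) / (2 * m ^ (n + 1)) := by
  have h := integral_rpow_mul_exp_neg_mul_rpow (p := 2) (q := (2 * n + 1 : ℕ)) (b := m) two_pos
    (by have : (0 : ℝ) ≤ (2 * n + 1 : ℕ) := Nat.cast_nonneg _
        linarith) hm
  have e1 : (((2 * n + 1 : ℕ) : ℝ) + 1) / 2 = (n : ℝ) + 1 := by push_cast; ring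
  have e2 : -(((2 * n + 1 : ℕ) : ℝ) + 1) / 2 = -((n + 1 : ℕ) : ℝ) := by push_cast; ring
  rw [e1, e2, Real.Gamma_nat_eq_factorial, Real.rpow_neg hm.le, Real.rpow_natCast] at h
  simp only [Real.rpow_natCast, Real.rpow_two] at h
  rw [h]
  field_simp

theorem integrableOn_pow_mul_gaussian {m : ℝ} (hm : 0 < m) (n : ℕ) :
    IntegrableOn (fun x : ℝ => x ^ n * Real.exp (-m * x ^ 2)) (Set.Ioi 0) := by
  have h := integrableOn_rpow_mul_exp_neg_mul_sq hm (s := n)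
    (by have : (0 : ℝ) ≤ (n : ℝ) := Nat.cast_nonneg _
        linarith)
  simpa only [Real.rpow_natCast] using h

theorem sum_fockKernelCoeff_mul {m : ℝ} (hm : 0 < m) {q n : ℕ} (hn : n < q) :
    ∑ i ∈ Finset.range q, fockKernelCoeff m q i * (((n + i).factorial : ℝ) / m ^ (n + i + 1)) =
      if n = 0 then 1 else 0 := by
  have h := sum_neg_one_pow_mul_choose_mul_ascFactorial hn
  have e : ∑ i ∈ Finset.range q, fockKernelCoeff m q i *
      (((n + i).factorial : ℝ) / m ^ (n + i + 1)) = (1 / m ^ n) * if n = 0 then 1 else 0 := by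
    rw [← h, Finset.mul_sum]
    refine Finset.sum_congr rfl fun i _ => ?_
    rw [fockKernelCoeff, pow_succ, pow_add]
    have := Nat.factorial_ne_zero i
    field_simp
  rw [e]
  split_ifs with h0
  · simp [h0]
  · simp

theorem fockKernel_zero_right (m : ℝ) {q : ℕ} (hq : 1 ≤ q) (z : ℂ) :
    fockKernel m q z 0 = ((∑ i ∈ Finset.range q, fockKernelCoeff m q i * (‖z‖ ^ 2) ^ i : ℝ) : ℂ) := by
  rw [← mul_laguerreL_one_eq_sum m hq]
  simp [fockKernel]

theorem IsPolyanalytic.integral_fockKernel_zero {m : ℝ} (hm : 0 < m) {q : ℕ} (hq : 1 ≤ q)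
    {f : ℂ → ℂ} (hf : IsPolyanalytic q f)
    (hint : Integrable fun z => ((Real.pi⁻¹ * Real.exp (-m * ‖z‖ ^ 2) : ℝ) : ℂ) *
      (conj (fockKernel m q z 0) * f z)) :
    ∫ z, ((Real.pi⁻¹ * Real.exp (-m * ‖z‖ ^ 2) : ℝ) : ℂ) * (conj (fockKernel m q z 0) * f z)
      = f 0 := by
  obtain ⟨c, hc0, hc⟩ := hf.exists_integral_circleMap hq
  have hcf := hf.continuous
  have hcK := (isPolyanalytic_fockKernel m hq 0).continuous
  have hcj := Complex.continuous_conj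
  rw [integral_eq_integral_circleMap (by fun_prop) hint]
  have e1 : ∀ ρ ∈ Set.Ioi (0 : ℝ), (ρ : ℂ) * ∫ θ in (-Real.pi)..Real.pi,
      ((Real.pi⁻¹ * Real.exp (-m * ‖circleMap 0 ρ θ‖ ^ 2) : ℝ) : ℂ) *
        (conj (fockKernel m q (circleMap 0 ρ θ) 0) * f (circleMap 0 ρ θ)) =
      ∑ r ∈ Finset.range q, ∑ i ∈ Finset.range q, (2 * c r * (fockKernelCoeff m q i : ℂ)) *
        ((ρ ^ (2 * (r + i) + 1) * Real.exp (-m * ρ ^ 2) : ℝ) : ℂ) := by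
    intro ρ hρ
    have hρ' : (0 : ℝ) < ρ := hρ
    simp_rw [fockKernel_zero_right m hq, norm_circleMap_zero, abs_of_pos hρ', Complex.conj_ofReal]
    rw [intervalIntegral.integral_const_mul, intervalIntegral.integral_const_mul, hc ρ hρ']
    have hpi : (Real.pi : ℂ) ≠ 0 := by exact_mod_cast Real.pi_ne_zero
    push_cast
    rw [Finset.sum_mul, Finset.mul_sum, Finset.mul_sum, Finset.sum_comm]
    refine Finset.sum_congr rfl fun i _ => ?_
    rw [Finset.mul_sum, Finset.mul_sum, Finset.mul_sum, Finset.mul_sum]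
    refine Finset.sum_congr rfl fun r _ => ?_
    field_simp
    ring
  have hi : ∀ n : ℕ, Integrable (fun ρ : ℝ => ((ρ ^ n * Real.exp (-m * ρ ^ 2) : ℝ) : ℂ))
      (volume.restrict (Set.Ioi 0)) := fun n => (integrableOn_pow_mul_gaussian hm n).ofReal
  rw [setIntegral_congr_fun measurableSet_Ioi e1, integral_finsetSum _ fun r _ =>
    integrable_finsetSum _ fun i _ => (hi _).const_mul _]
  have e2 : ∀ r ∈ Finset.range q, ∫ ρ in Set.Ioi (0 : ℝ), ∑ i ∈ Finset.range q,
      (2 * c r * (fockKernelCoeff m q i : ℂ)) *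
        ((ρ ^ (2 * (r + i) + 1) * Real.exp (-m * ρ ^ 2) : ℝ) : ℂ) =
      c r * ((if r = 0 then 1 else 0 : ℝ) : ℂ) := by
    intro r hr
    rw [integral_finsetSum _ fun i _ => (hi _).const_mul _,
      ← sum_fockKernelCoeff_mul hm (Finset.mem_range.1 hr), Complex.ofReal_sum, Finset.mul_sum]
    refine Finset.sum_congr rfl fun i _ => ?_
    rw [integral_const_mul, integral_complex_ofReal, integral_pow_mul_gaussian hm]
    push_cast
    have : (m : ℂ) ≠ 0 := by exact_mod_cast hm.ne'
    field_simp
  rw [Finset.sum_congr rfl e2, Finset.sum_eq_single_of_mem 0 (Finset.mem_range.2 hq)]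
  · simp [hc0]
  · intro r _ hr
    simp [hr]

/-! ### The reproducing property at an arbitrary point. -/

theorem gaussian_mul_conj_fockKernel_add (m : ℝ) (q : ℕ) (z w : ℂ) :
    ((Real.pi⁻¹ * Real.exp (-m * ‖z + w‖ ^ 2) : ℝ) : ℂ) * conj (fockKernel m q (z + w) w) =
      ((Real.pi⁻¹ * Real.exp (-m * ‖z‖ ^ 2) : ℝ) : ℂ) *
        (conj (fockKernel m q z 0) * Complex.exp (-m * conj w * z)) := by
  have h : Complex.exp (-m * ‖z + w‖ ^ 2) * Complex.exp (m * conj (z + w) * w) =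
      Complex.exp (-m * ‖z‖ ^ 2) * Complex.exp (-m * conj w * z) := by
    rw [← Complex.exp_add, ← Complex.exp_add, ← Complex.conj_mul', ← Complex.conj_mul', map_add]
    ring_nf
  simp only [fockKernel, map_mul, Complex.conj_ofReal, ← Complex.exp_conj, Complex.conj_conj,
    add_sub_cancel_right, map_zero, mul_zero, Complex.exp_zero, mul_one, sub_zero]
  push_cast
  linear_combination ((Real.pi : ℂ)⁻¹ * m * (laguerreL 1 (q - 1) (m * ‖z‖ ^ 2) : ℂ)) * h

theorem IsPolyanalytic.integral_fockKernel {m : ℝ} (hm : 0 < m) {q : ℕ} (hq : 1 ≤ q)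
    {f : ℂ → ℂ} (hf : IsPolyanalytic q f) (hL : MemLp f 2 (fockMeasure m)) (w : ℂ) :
    ∫ z, conj (fockKernel m q z w) * f z ∂fockMeasure m = f w := by
  have hi : Integrable (fun z => conj (fockKernel m q z w) * f z) (fockMeasure m) :=
    (memLp_fockKernel hm hq w).star.integrable_mul hL
  rw [integrable_fockMeasure_iff] at hi
  simp only [Complex.real_smul] at hi
  rw [integral_fockMeasure, ← integral_add_right_eq_self _ w]
  have hi' := hi.comp_add_right w
  simp only [← mul_assoc, gaussian_mul_conj_fockKernel_add] at hi' ⊢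
  simp only [mul_assoc] at hi' ⊢
  -- The translated function with its exponential factor is again polyanalytic of the same order and
  -- has value `f w` at `0`.
  have hG : IsPolyanalytic q fun z => f (z + w) * Complex.exp (-m * conj w * z) :=
    (hf.comp_add w).mul_differentiable (by fun_prop)
  have := hG.integral_fockKernel_zero hm hq (by
    refine hi'.congr (Filter.Eventually.of_forall fun z => ?_)
    simp only [mul_assoc]
    ring)
  simp only [mul_zero, Complex.exp_zero, mul_one, zero_add] at this
  rw [← this]
  refine integral_congr_ae (Filter.Eventually.of_forall fun z => ?_)
  simp only [mul_assoc]
  ring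

/-! ### Pairing the kernel with an arbitrary `L²` function. -/

theorem ExpBounded.exp_mul_conj_mul (c w : ℂ) :
    ExpBounded fun z => Complex.exp (c * conj z * w) :=
  ⟨1, ‖c‖ * ‖w‖, fun z => (norm_exp_le_exp_norm _).trans (le_of_eq (by
    simp only [norm_mul, RCLike.norm_conj]
    ring_nf))⟩

theorem differentiable_integral_mul_exp {m : ℝ} (hm : 0 < m) {F p : ℂ → ℂ}
    (hF : MemLp F 2 (fockMeasure m)) (hp : ExpBounded p) (hpc : Continuous p) :
    Differentiable ℂ fun w =>
      ∫ z, F z * (p z * Complex.exp (m * conj z * w)) ∂fockMeasure m := by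
  intro w₀
  have hcj := Complex.continuous_conj
  have hexp := ExpBounded.exp_mul_conj_mul (m : ℂ)
  have hint : ∀ w : ℂ, Integrable (fun z => F z * (p z * Complex.exp (m * conj z * w)))
      (fockMeasure m) := fun w =>
    hF.integrable_mul ((hp.mul (hexp w)).memLp (by fun_prop) hm)
  have hF'int : ∀ w : ℂ, Integrable (fun z => F z * (p z * (Complex.exp (m * conj z * w) *
      (m * conj z)))) (fockMeasure m) := fun w =>
    hF.integrable_mul ((hp.mul ((hexp w).mul ((ExpBounded.const _).mul .conj))).memLp
      (by fun_prop) hm)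
  have hH : ExpBounded fun z => p z * (Complex.exp ((‖(m : ℂ)‖ * (‖w₀‖ + 1) * ‖z‖ : ℝ)) *
      (m * conj z)) := by
    refine hp.mul (ExpBounded.mul ⟨1, ‖(m : ℂ)‖ * (‖w₀‖ + 1), fun z => ?_⟩
      ((ExpBounded.const _).mul .conj))
    rw [Complex.norm_exp, Complex.ofReal_re, one_mul]
  -- On the unit ball around `w₀` one has `‖w‖ ≤ ‖w₀‖ + 1`, which gives a bound on the exponential
  -- independent of `w`.
  refine (hasDerivAt_integral_of_dominated_loc_of_deriv_le
    (bound := fun z => ‖F z * (p z * (Complex.exp ((‖(m : ℂ)‖ * (‖w₀‖ + 1) * ‖z‖ : ℝ)) *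
      (m * conj z)))‖) (F' := fun w z => F z * (p z * (Complex.exp (m * conj z * w) *
      (m * conj z)))) (Metric.ball_mem_nhds w₀ one_pos)
    (Filter.Eventually.of_forall fun w => (hint w).1) (hint w₀) (hF'int w₀).1
    (Filter.Eventually.of_forall fun z w hw => ?_)
    (hF.integrable_mul (hH.memLp (by fun_prop) hm)).norm
    (Filter.Eventually.of_forall fun z w _ => ?_)).2.differentiableAt
  · rw [norm_mul, norm_mul, norm_mul, norm_mul (F z), norm_mul (p z), norm_mul (Complex.exp _)]
    have hw' : ‖w‖ ≤ ‖w₀‖ + 1 := by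
      have h1 := norm_le_norm_add_norm_sub' w w₀
      have h2 : ‖w - w₀‖ < 1 := by simpa [dist_eq_norm] using hw
      rw [norm_sub_rev] at h1
      rw [norm_sub_rev] at h2
      linarith
    have : ‖Complex.exp (m * conj z * w)‖ ≤
        ‖Complex.exp ((‖(m : ℂ)‖ * (‖w₀‖ + 1) * ‖z‖ : ℝ))‖ := by
      rw [Complex.norm_exp (Complex.ofReal _), Complex.ofReal_re]
      refine (norm_exp_le_exp_norm _).trans (Real.exp_le_exp.2 ?_)
      simp only [norm_mul, RCLike.norm_conj]
      calc ‖(m : ℂ)‖ * ‖z‖ * ‖w‖ ≤ ‖(m : ℂ)‖ * ‖z‖ * (‖w₀‖ + 1) := by gcongr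
        _ = _ := by ring
    gcongr
  · have h1 : HasDerivAt (fun w : ℂ => (m : ℂ) * conj z * w) (m * conj z) w := by
      simpa using (hasDerivAt_id w).const_mul ((m : ℂ) * conj z)
    exact (h1.cexp.const_mul (p z)).const_mul (F z)

/-- By Hermitian symmetry, the conjugated kernel is a polynomial in `w̄` of degree less than `q`
whose coefficients are entire in `w`; integration in `z` preserves this form. -/
theorem isPolyanalytic_integral_fockKernel {m : ℝ} (hm : 0 < m) {q : ℕ} (hq : 1 ≤ q)
    {F : ℂ → ℂ} (hF : MemLp F 2 (fockMeasure m)) :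
    IsPolyanalytic q fun w => ∫ z, conj (fockKernel m q z w) * F z ∂fockMeasure m := by
  have hcj := Complex.continuous_conj
  have hp : ∀ i a b : ℕ, ExpBounded fun z => (-conj z) ^ (i - b) * (-z) ^ (i - a) := fun i a b =>
    ((ExpBounded.conj.congr_norm fun z => norm_neg _).pow _).mul
      ((ExpBounded.id.congr_norm fun z => norm_neg _).pow _)
  have hexp := ExpBounded.exp_mul_conj_mul (m : ℂ)
  have hint : ∀ (i a b : ℕ) (w : ℂ), Integrable (fun z => F z * (((-conj z) ^ (i - b) *
      (-z) ^ (i - a)) * Complex.exp (m * conj z * w))) (fockMeasure m) := fun i a b w =>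
    hF.integrable_mul (((hp i a b).mul (hexp w)).memLp (by fun_prop) hm)
  have e : (fun w => ∫ z, conj (fockKernel m q z w) * F z ∂fockMeasure m) = fun w =>
      ∑ i ∈ Finset.range q, ∑ b ∈ Finset.range (i + 1), ∑ a ∈ Finset.range (i + 1),
        conj w ^ b * (((fockKernelCoeff m q i : ℂ) * (i.choose b : ℂ) * (i.choose a : ℂ)) *
          w ^ a * ∫ z, F z * (((-conj z) ^ (i - b) * (-z) ^ (i - a)) *
            Complex.exp (m * conj z * w)) ∂fockMeasure m) := by
    ext w
    have e1 : ∀ z, conj (fockKernel m q z w) * F z =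
        ∑ i ∈ Finset.range q, ∑ b ∈ Finset.range (i + 1), ∑ a ∈ Finset.range (i + 1),
        (conj w ^ b * (((fockKernelCoeff m q i : ℂ) * (i.choose b : ℂ) * (i.choose a : ℂ)) *
          w ^ a)) * (F z * (((-conj z) ^ (i - b) * (-z) ^ (i - a)) *
            Complex.exp (m * conj z * w))) := by
      intro z
      rw [conj_fockKernel, fockKernel_eq_sum m hq, Finset.sum_mul]
      refine Finset.sum_congr rfl fun i _ => ?_
      rw [sub_eq_add_neg, sub_eq_add_neg, add_pow, add_pow, Finset.sum_mul, Finset.sum_mul]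
      refine Finset.sum_congr rfl fun b _ => ?_
      rw [Finset.mul_sum, Finset.sum_mul, Finset.mul_sum, Finset.sum_mul]
      refine Finset.sum_congr rfl fun a _ => ?_
      ring
    simp_rw [e1]
    rw [integral_finsetSum _ fun i _ => integrable_finsetSum _ fun b _ =>
      integrable_finsetSum _ fun a _ => (hint i a b w).const_mul _]
    refine Finset.sum_congr rfl fun i _ => ?_
    rw [integral_finsetSum _ fun b _ =>
      integrable_finsetSum _ fun a _ => (hint i a b w).const_mul _]
    refine Finset.sum_congr rfl fun b _ => ?_
    rw [integral_finsetSum _ fun a _ => (hint i a b w).const_mul _]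
    refine Finset.sum_congr rfl fun a _ => ?_
    rw [integral_const_mul, mul_assoc (conj w ^ b)]
  rw [e]
  refine .sum _ fun i hi => .sum _ fun b hb => .sum _ fun a _ =>
    (isPolyanalytic_conj_pow ?_).mul_differentiable ?_
  · have := Finset.mem_range.1 hi
    have := Finset.mem_range.1 hb
    omega
  · exact ((differentiable_const _).mul (differentiable_id.pow a)).mul
      (differentiable_integral_mul_exp hm hF (hp i a b) (by fun_prop))

/-! ### Completeness and the reproducing kernel Hilbert space. -/

/-- The kernel function `K_{m,q}(·, w)` as an element of `A²_{m,q}(ℂ)`. -/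
noncomputable def PolyFock.kernelFun {m : ℝ} (hm : 0 < m) {q : ℕ} (hq : 1 ≤ q) (w : ℂ) :
    PolyFock m q :=
  ⟨fun z => fockKernel m q z w, isPolyanalytic_fockKernel m hq w, memLp_fockKernel hm hq w⟩

theorem PolyFock.inner_def {m : ℝ} {q : ℕ} (f g : PolyFock m q) :
    inner ℂ f g = ∫ z, conj (f.toFun z) * g.toFun z ∂fockMeasure m := rfl

theorem PolyFock.inner_kernelFun {m : ℝ} (hm : 0 < m) {q : ℕ} (hq : 1 ≤ q) (w : ℂ)
    (f : PolyFock m q) : inner ℂ (PolyFock.kernelFun hm hq w) f = f.toFun w :=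
  IsPolyanalytic.integral_fockKernel hm hq f.2.1 f.2.2 w

theorem PolyFock.memLp {m : ℝ} {q : ℕ} (f : PolyFock m q) : MemLp f.toFun 2 (fockMeasure m) :=
  f.2.2

/-- The isometric inclusion of `A²_{m,q}(ℂ)` into `L²`. -/
noncomputable def PolyFock.toLp (m : ℝ) (q : ℕ) : PolyFock m q →ₗᵢ[ℂ] Lp ℂ 2 (fockMeasure m) :=
  LinearMap.isometryOfInner
    { toFun := fun f => MemLp.toLp f.toFun f.memLp
      map_add' := fun f g => MemLp.toLp_add f.memLp g.memLp
      map_smul' := fun c f => MemLp.toLp_const_smul c f.memLp } fun f g => by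
    rw [L2.inner_def, PolyFock.inner_def]
    refine integral_congr_ae ?_
    filter_upwards [MemLp.coeFn_toLp f.memLp, MemLp.coeFn_toLp g.memLp] with z hf hg
    change MemLp.toLp g.toFun g.memLp z * conj (MemLp.toLp f.toFun f.memLp z) = _
    rw [hf, hg, mul_comm]

theorem PolyFock.coeFn_toLp {m : ℝ} {q : ℕ} (f : PolyFock m q) :
    (PolyFock.toLp m q f : ℂ → ℂ) =ᵐ[fockMeasure m] f.toFun :=
  MemLp.coeFn_toLp f.memLp

/-- Reproduction turns `L²` convergence into pointwise convergence to `⟪K_w, F⟫`. An a.e. convergent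
subsequence identifies this limit with `F`. -/
theorem PolyFock.isClosed_range_toLp {m : ℝ} (hm : 0 < m) {q : ℕ} (hq : 1 ≤ q) :
    IsClosed (Set.range (PolyFock.toLp m q)) := by
  refine IsSeqClosed.isClosed fun u F hu hF => ?_
  choose v hv using hu
  obtain ⟨ns, hns, hae⟩ := (tendstoInMeasure_of_tendsto_Lp hF).exists_seq_tendsto_ae
  have hpt : ∀ w, Filter.Tendsto (fun n => (v n).toFun w) Filter.atTop
      (nhds (∫ z, conj (fockKernel m q z w) * F z ∂fockMeasure m)) := by
    intro w
    have h := (tendsto_const_nhds (x := PolyFock.toLp m q (PolyFock.kernelFun hm hq w))).inner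
      (𝕜 := ℂ) hF
    have e2 : inner ℂ (PolyFock.toLp m q (PolyFock.kernelFun hm hq w)) F =
        ∫ z, conj (fockKernel m q z w) * F z ∂fockMeasure m := by
      rw [L2.inner_def]
      refine integral_congr_ae ?_
      filter_upwards [PolyFock.coeFn_toLp (PolyFock.kernelFun hm hq w)] with z hz
      rw [RCLike.inner_apply, hz, mul_comm]
      rfl
    rw [e2] at h
    refine h.congr fun n => ?_
    rw [← hv n, LinearIsometry.inner_map_map, PolyFock.inner_kernelFun]
  have hFe : (F : ℂ → ℂ) =ᵐ[fockMeasure m]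
      fun w => ∫ z, conj (fockKernel m q z w) * F z ∂fockMeasure m := by
    have hall : ∀ᵐ w ∂fockMeasure m, ∀ n, (u n : ℂ → ℂ) w = (v n).toFun w := by
      rw [ae_all_iff]
      intro n
      rw [← hv n]
      exact PolyFock.coeFn_toLp (v n)
    filter_upwards [hae, hall] with w h1 h2
    simp only [h2] at h1
    exact tendsto_nhds_unique h1 ((hpt w).comp hns.tendsto_atTop)
  refine ⟨⟨_, isPolyanalytic_integral_fockKernel hm hq (Lp.memLp F),
    (memLp_congr_ae hFe).1 (Lp.memLp F)⟩, ?_⟩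
  refine Lp.ext ((PolyFock.coeFn_toLp _).trans hFe.symm)

theorem PolyFock.completeSpace {m : ℝ} (hm : 0 < m) {q : ℕ} (hq : 1 ≤ q) :
    CompleteSpace (PolyFock m q) :=
  (completeSpace_iff_isComplete_range (PolyFock.toLp m q).isometry.isUniformInducing).2
    (PolyFock.isClosed_range_toLp hm hq).isComplete

/-- `A²_{m,q}(ℂ)` as a reproducing kernel Hilbert space of functions on `ℂ`. -/
@[reducible]
noncomputable def PolyFock.rkhs {m : ℝ} (hm : 0 < m) {q : ℕ} (hq : 1 ≤ q) :
    RKHS ℂ (PolyFock m q) ℂ ℂ where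
  coeCLM :=
    { toFun := PolyFock.toFun
      map_add' := fun _ _ => rfl
      map_smul' := fun _ _ => rfl
      cont := continuous_pi fun w => by
        simp only [← PolyFock.inner_kernelFun hm hq w]
        fun_prop }
  coeCLM_injective := fun _ _ h => Subtype.ext h

/-! ### The Laguerre series of the kernel. -/

/-- The terms of the series expansion of the kernel. -/
noncomputable def laguerreTerm (r i : ℕ) (c : ℂ) (x y : ℝ) : ℂ :=
  ((r.factorial : ℂ) / ((r + i).factorial : ℂ)) * c ^ i * (laguerreL i r x : ℂ) *
    (laguerreL i r y : ℂ)

theorem complexHermite_mul_complexHermite (r i : ℕ) (z w : ℂ) :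
    complexHermite (r + i) r z (conj z) * complexHermite (r + i) r (conj w) w =
      (r.factorial : ℂ) * ((r + i).factorial : ℂ) *
        laguerreTerm r i (z * conj w) (‖z‖ ^ 2) (‖w‖ ^ 2) := by
  rw [complexHermite_add_left_eq_laguerreL i r z (conj z) (‖z‖ ^ 2)
      (by rw [Complex.mul_conj']; push_cast; rfl),
    complexHermite_add_left_eq_laguerreL i r (conj w) w (‖w‖ ^ 2)
      (by rw [Complex.conj_mul']; push_cast; rfl), laguerreTerm]
  have h1 : ((-1 : ℂ) ^ r) * (-1) ^ r = 1 := by rw [← mul_pow]; simp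
  have h2 : ((r + i).factorial : ℂ) ≠ 0 := by exact_mod_cast (r + i).factorial_ne_zero
  field_simp
  rw [mul_pow]
  linear_combination ((r.factorial : ℂ) ^ 2 * z ^ i * conj w ^ i *
    (laguerreL i r (‖z‖ ^ 2) : ℂ) * (laguerreL i r (‖w‖ ^ 2) : ℂ)) * h1

theorem complexHermite_mul_complexHermite' (j k : ℕ) (z w : ℂ) :
    complexHermite j (j + k) z (conj z) * complexHermite j (j + k) (conj w) w =
      (j.factorial : ℂ) * ((j + k).factorial : ℂ) *
        laguerreTerm j k (conj z * w) (‖z‖ ^ 2) (‖w‖ ^ 2) := by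
  have h := complexHermite_mul_complexHermite j k (conj z) (conj w)
  simp only [Complex.conj_conj, RCLike.norm_conj] at h
  rw [complexHermite_symm j, complexHermite_symm j, h]

theorem hasSum_laguerreTerm (r : ℕ) (z w : ℂ) :
    HasSum (fun i => laguerreTerm r i (z * conj w) (‖z‖ ^ 2) (‖w‖ ^ 2))
      ((laguerreL 0 r (‖z - w‖ ^ 2) : ℂ) * Complex.exp (z * conj w) -
        ∑ j ∈ Finset.range r, laguerreTerm j (r - j) (conj z * w) (‖z‖ ^ 2) (‖w‖ ^ 2)) := by
  have hr : (r.factorial : ℂ) ≠ 0 := by exact_mod_cast r.factorial_ne_zero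
  have h := (hasSum_complexHermite_mul r r z (conj z) w (conj w)).div_const (r.factorial : ℂ)
  have hv := complexHermite_add_left_eq_laguerreL 0 r (conj z - conj w) (z - w) (‖z - w‖ ^ 2)
    (by rw [← map_sub, Complex.conj_mul']; push_cast; rfl)
  rw [Nat.add_zero] at hv
  -- The terms `n < r` go to the other side; the rest is reindexed by `n = r + i`.
  rw [hv, ← hasSum_nat_add_iff' r] at h
  convert! h using 1
  · ext i
    rw [Nat.add_comm i r, complexHermite_mul_complexHermite]
    have h2 : ((r + i).factorial : ℂ) ≠ 0 := by exact_mod_cast (r + i).factorial_ne_zero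
    field_simp
  · have h1 : ((-1 : ℂ) ^ r) * (-1) ^ r = 1 := by rw [← mul_pow]; simp
    congr 1
    · field_simp
      rw [← sq] at h1
      linear_combination (-(laguerreL 0 r (‖z - w‖ ^ 2) : ℂ)) * h1
    · refine Finset.sum_congr rfl fun j hj => ?_
      obtain ⟨k, rfl⟩ := Nat.exists_eq_add_of_lt (Finset.mem_range.1 hj)
      rw [add_assoc, complexHermite_mul_complexHermite', Nat.add_sub_cancel_left]
      have h2 : (j.factorial : ℂ) ≠ 0 := by exact_mod_cast j.factorial_ne_zero
      rw [add_assoc] at hr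
      field_simp

/-- The substitution `r = j + k`; `j < r < q` becomes `1 ≤ k ≤ q - j - 1`, which forces `j < q - 1`.
-/
theorem sum_range_sum_range_sub {M : Type*} [AddCommMonoid M] (q : ℕ) (T : ℕ → ℕ → M) :
    ∑ r ∈ Finset.range q, ∑ j ∈ Finset.range r, T j (r - j) =
      ∑ j ∈ Finset.range (q - 1), ∑ k ∈ Finset.Icc 1 (q - j - 1), T j k := by
  rw [Finset.sum_sigma', Finset.sum_sigma']
  refine Finset.sum_nbij' (fun p => ⟨p.2, p.1 - p.2⟩) (fun p => ⟨p.1 + p.2, p.1⟩) ?_ ?_ ?_ ?_ ?_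
  · rintro ⟨r, j⟩ h
    simp only [Finset.mem_sigma, Finset.mem_range, Finset.mem_Icc] at h ⊢
    omega
  · rintro ⟨j, k⟩ h
    simp only [Finset.mem_sigma, Finset.mem_range, Finset.mem_Icc] at h ⊢
    omega
  · rintro ⟨r, j⟩ h
    simp only [Finset.mem_sigma, Finset.mem_range] at h
    simp only [Sigma.mk.injEq, heq_eq_eq, and_true]
    omega
  · rintro ⟨j, k⟩ h
    simp
  · rintro ⟨r, j⟩ h
    rfl

theorem hasSum_laguerreTerm_scaled {m : ℝ} (hm : 0 < m) (r : ℕ) (z w : ℂ) :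
    HasSum (fun i => laguerreTerm r i (m * z * conj w) (m * ‖z‖ ^ 2) (m * ‖w‖ ^ 2))
      ((laguerreL 0 r (m * ‖z - w‖ ^ 2) : ℂ) * Complex.exp (m * z * conj w) -
        ∑ j ∈ Finset.range r,
          laguerreTerm j (r - j) (m * conj z * w) (m * ‖z‖ ^ 2) (m * ‖w‖ ^ 2)) := by
  -- Dilation by `√m` reduces to the case `m = 1`.
  have h := hasSum_laguerreTerm r (√m * z) (√m * w)
  have hs : ((√m : ℝ) : ℂ) * (√m : ℝ) = m := by
    rw [← Complex.ofReal_mul, Real.mul_self_sqrt hm.le]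
  have hn : ∀ v : ℂ, ‖((√m : ℝ) : ℂ) * v‖ ^ 2 = m * ‖v‖ ^ 2 := fun v => by
    rw [norm_mul, mul_pow, Complex.norm_real, Real.norm_of_nonneg (Real.sqrt_nonneg m),
      Real.sq_sqrt hm.le]
  have e1 : (√m : ℝ) * z * ((√m : ℝ) * conj w) = m * z * conj w := by
    rw [← hs]
    ring
  have e2 : (√m : ℝ) * conj z * ((√m : ℝ) * w) = m * conj z * w := by
    rw [← hs]
    ring
  simpa only [← mul_sub, hn, map_mul, Complex.conj_ofReal, e1, e2] using h

theorem fockKernel_eq_series {m : ℝ} (hm : 0 < m) {q : ℕ} (hq : 1 ≤ q) (z w : ℂ) :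
    fockKernel m q z w =
      (m : ℂ) * ∑ r ∈ Finset.range q, ∑' i : ℕ,
          laguerreTerm r i (m * z * conj w) (m * ‖z‖ ^ 2) (m * ‖w‖ ^ 2) +
      (m : ℂ) * ∑ j ∈ Finset.range (q - 1), ∑ k ∈ Finset.Icc 1 (q - j - 1),
          laguerreTerm j k (m * conj z * w) (m * ‖z‖ ^ 2) (m * ‖w‖ ^ 2) := by
  rw [← sum_range_sum_range_sub q fun j k =>
    laguerreTerm j k (m * conj z * w) (m * ‖z‖ ^ 2) (m * ‖w‖ ^ 2), ← mul_add,
    ← Finset.sum_add_distrib, fockKernel, laguerreL_one_eq_sum, Nat.sub_add_cancel hq, mul_assoc,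
    Complex.ofReal_sum, Finset.sum_mul]
  congr 1
  refine Finset.sum_congr rfl fun r _ => ?_
  rw [(hasSum_laguerreTerm_scaled hm r z w).tsum_eq]
  ring

/-! ### Identification of the kernel and conclusion. -/

theorem PolyFock.kernel_rkhs {m : ℝ} (hm : 0 < m) {q : ℕ} (hq : 1 ≤ q)
    [CompleteSpace (PolyFock m q)] (z w : ℂ) :
    letI := PolyFock.rkhs hm hq
    RKHS.kernel (PolyFock m q) z w 1 = fockKernel m q z w := by
  let _ := PolyFock.rkhs hm hq
  -- Both vectors represent evaluation at `w`, so they coincide.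
  have h : RKHS.kerFun (PolyFock m q) w (1 : ℂ) = PolyFock.kernelFun hm hq w := by
    refine ext_inner_right ℂ fun f => ?_
    rw [RKHS.kerFun_inner, PolyFock.inner_kernelFun]
    simp only [RCLike.inner_apply, map_one, mul_one]
    rfl
  rw [← RKHS.kerFun_apply, h]
  rfl

theorem mainTheorem5 (m : ℝ) (hm : 0 < m) (q : ℕ) (hq : 1 ≤ q) :
    ∃ (_ : CompleteSpace (PolyFock m q)) (_ : RKHS ℂ (PolyFock m q) ℂ ℂ),
      (∀ f : PolyFock m q, RKHS.coeCLM ℂ f = f.toFun) ∧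
      ∀ z w : ℂ,
        RKHS.kernel (PolyFock m q) z w 1 =
            (m : ℂ) * (laguerreL 1 (q - 1) (m * ‖z - w‖ ^ 2) : ℂ) * Complex.exp (m * z * conj w) ∧
        (∀ r < q, Summable fun i : ℕ =>
          ((r.factorial : ℂ) / ((r + i).factorial : ℂ)) * (m * z * conj w) ^ i *
            (laguerreL i r (m * ‖z‖ ^ 2) : ℂ) * (laguerreL i r (m * ‖w‖ ^ 2) : ℂ)) ∧
        RKHS.kernel (PolyFock m q) z w 1 =
          (m : ℂ) * ∑ r ∈ Finset.range q, ∑' i : ℕ,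
              ((r.factorial : ℂ) / ((r + i).factorial : ℂ)) * (m * z * conj w) ^ i *
                (laguerreL i r (m * ‖z‖ ^ 2) : ℂ) * (laguerreL i r (m * ‖w‖ ^ 2) : ℂ) +
          (m : ℂ) * ∑ j ∈ Finset.range (q - 1), ∑ k ∈ Finset.Icc 1 (q - j - 1),
              ((j.factorial : ℂ) / ((j + k).factorial : ℂ)) * (m * conj z * w) ^ k *
                (laguerreL k j (m * ‖z‖ ^ 2) : ℂ) * (laguerreL k j (m * ‖w‖ ^ 2) : ℂ) := by
  have := PolyFock.completeSpace hm hq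
  refine ⟨this, PolyFock.rkhs hm hq, fun _ => rfl, fun z w => ?_⟩
  rw [PolyFock.kernel_rkhs hm hq]
  -- In `ℂ`, `Summable` is equivalent to absolute convergence.
  exact ⟨rfl, fun r _ => (hasSum_laguerreTerm_scaled hm r z w).summable,
    fockKernel_eq_series hm hq z w⟩
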